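/- Let $D$ be a Prüfer domain (an integral domain such that the localization $D_P$ is a valuation domain for every prime ideal $P$), with fraction field $K$. The inverse topology on $\operatorname{Spec}(D)$ is the topology having the sets $V(I)=\{P\in\operatorname{Spec}(D) : I\subseteq P\}$, for $I$ ranging among the finitely generated ideals of $D$, as a subbasis of open sets. Let $X$ be a set of maximal ideals of $D$ that is a discrete splitting set, that is: $X$ is closed under specialization (every prime ideal containing a member of $X$ is in $X$), $X$ is open in the inverse topology, and $P\neq P^2$ for every $P\in X$. Let $\operatorname{Inv}_X(D)$ be the set of invertible fractional ideals $I$ of $D$ such that $ID_P=D_P$ for every $P\in\operatorname{Spec}(D)\setminus X$. An ideal $M\in X$ is called critical with respect to $X$ if no radical ideal $I$ of $D$ with $I\in\operatorname{Inv}_X(D)$ satisfies $I\subseteq M$; let $\operatorname{Crit}_X(D)$ be the set of all critical ideals $M\in X$. Then $X\setminus\operatorname{Crit}_X(D)$ is dense in $X$, with respect to the topology induced on $X$ by the inverse topology. -/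

import Mathlib

open scoped nonZeroDivisors Topology

noncomputable section

namespace PruferCritical

/-- A Prüfer domain: an integral domain all of whose localizations at prime ideals are
valuation domains. -/
def IsPruferDomain (D : Type*) [CommRing D] [IsDomain D] : Prop :=
  ∀ P : PrimeSpectrum D, ValuationRing (Localization.AtPrime P.asIdeal)

/-- The set of maximal ideals of `R`, as a subset of the prime spectrum. -/
def maxSpec (R : Type*) [CommRing R] : Set (PrimeSpectrum R) :=
  {P | P.asIdeal.IsMaximal}

/-- The inverse topology on the prime spectrum: the sets `V(I)`, with `I` a finitely generated
ideal, are a subbasis of open sets. -/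
abbrev inverseTopology (R : Type*) [CommRing R] : TopologicalSpace (PrimeSpectrum R) :=
  TopologicalSpace.generateFrom
    {U | ∃ I : Ideal R, I.FG ∧ U = PrimeSpectrum.zeroLocus (I : Set R)}

/-- The closure under specialization: the primes that contain some member of `X`. -/
def specializationClosure {R : Type*} [CommRing R] (X : Set (PrimeSpectrum R)) :
    Set (PrimeSpectrum R) :=
  {P | ∃ Q ∈ X, Q.asIdeal ≤ P.asIdeal}

/-- A splitting set: closed under specialization, and open in the inverse topology. -/
def IsSplittingSet {R : Type*} [CommRing R] (X : Set (PrimeSpectrum R)) : Prop :=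
  X = specializationClosure X ∧ IsOpen[inverseTopology R] X

/-- A discrete splitting set: a splitting set none of whose members is idempotent. -/
def IsDiscreteSplittingSet {R : Type*} [CommRing R] (X : Set (PrimeSpectrum R)) : Prop :=
  IsSplittingSet X ∧ ∀ P ∈ X, P.asIdeal ≠ P.asIdeal ^ 2

section Domain

variable {D : Type*} [CommRing D] [IsDomain D]

/-- The localization `D_P`, as a subring of the fraction field of `D`. -/
def localizationAt (P : PrimeSpectrum D) : Subalgebra D (FractionRing D) :=
  Localization.subalgebra.ofField (FractionRing D) P.asIdeal.primeCompl
    P.asIdeal.primeCompl_le_nonZeroDivisors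

/-- The support of a fractional ideal `I`: the primes `P` with `I D_P ≠ D_P`. -/
def supp (I : FractionalIdeal D⁰ (FractionRing D)) : Set (PrimeSpectrum D) :=
  {P | (I : Submodule D (FractionRing D)) * Subalgebra.toSubmodule (localizationAt P) ≠
    Subalgebra.toSubmodule (localizationAt P)}

/-- The set `Inv_X(D)` of invertible fractional ideals with support contained in `X`. -/
def InvX (X : Set (PrimeSpectrum D)) : Set (FractionalIdeal D⁰ (FractionRing D)) :=
  {I | (∃ J, I * J = 1) ∧ supp I ⊆ X}

/-- The set `Crit_X(D)`: those `M ∈ X` that contain no radical ideal of `D` lying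
in `Inv_X(D)`. -/
def Crit (X : Set (PrimeSpectrum D)) : Set (PrimeSpectrum D) :=
  {M | M ∈ X ∧ ¬ ∃ I : Ideal D, I.IsRadical ∧
    (I : FractionalIdeal D⁰ (FractionRing D)) ∈ InvX X ∧ I ≤ M.asIdeal}

end Domain

end PruferCritical

end

/-!
Let `J` be a nonzero finitely generated ideal with `V(J)` nonempty and contained in `X`; such sets
`V(J)` are a basis of the open subsets of `X`, so it suffices to find a proper, finitely generated
*radical* ideal `I ⊇ J`. Indeed `I` is then invertible, because a finitely generated ideal of a
Prüfer domain is locally principal (`isUnit_coeIdeal_of_fg`), its support is contained in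
`V(I) ⊆ V(J) ⊆ X` (`supp_coeIdeal_subset_zeroLocus`), and every prime in `V(I)` is non-critical.

The ideal `I` is found by contradiction. If a proper finitely generated ideal `J` is not radical,
say `c ^ 2 ∈ J` and `c ∉ J`, then `L = J + (c)` is invertible, so `J = L * J'` with `J' = (J : c)`,
and `L ⊆ J'` since `c ^ 2 ∈ J`. Hence `J ⊆ J' ^ 2`, and `J'` is again proper and finitely generated
(`exists_le_sq_of_not_isRadical`). If no finitely generated proper ideal containing `J` is radical,
this step can be repeated forever, which gives an increasing chain of proper ideals `J k` with
`J ⊆ (J k) ^ (2 ^ k)`. A maximal ideal `M` containing all of them contains `J` in every power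
(`exists_isMaximal_forall_le_pow`). But `M ∈ X`, so that `M ≠ M ^ 2` and `M D_M` is principal, while
all primes containing `J` are maximal, so that `J D_M` contains a power of `M D_M`; therefore `J`
is not contained in all powers of `M` (`exists_not_le_pow`).
-/

open scoped nonZeroDivisors Topology

namespace PruferCritical

/-! ### The inverse topology, and ideals of commutative rings -/

section Ring

variable {R : Type*} [CommRing R]

/-- The sets `V(J)` with `J` finitely generated are a basis of the inverse topology, not just a
subbasis: `V(I) ∩ V(J) = V(I + J)`. -/
lemma exists_fg_zeroLocus_subset {W : Set (PrimeSpectrum R)}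
    (hW : IsOpen[inverseTopology R] W) {P : PrimeSpectrum R} (hP : P ∈ W) :
    ∃ J : Ideal R, J.FG ∧ J ≤ P.asIdeal ∧ PrimeSpectrum.zeroLocus (J : Set R) ⊆ W := by
  change TopologicalSpace.GenerateOpen _ W at hW
  induction hW with
  | basic U hU =>
    obtain ⟨I, hI, rfl⟩ := hU
    exact ⟨I, hI, hP, subset_rfl⟩
  | univ => exact ⟨⊥, Submodule.fg_bot, bot_le, Set.subset_univ _⟩
  | inter U V _ _ ihU ihV =>
    obtain ⟨I, hI, hIP, hIU⟩ := ihU hP.1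
    obtain ⟨J, hJ, hJP, hJV⟩ := ihV hP.2
    refine ⟨I ⊔ J, Submodule.FG.sup hI hJ, sup_le hIP hJP, fun Q hQ => ?_⟩
    have hQ' : I ⊔ J ≤ Q.asIdeal := hQ
    exact ⟨hIU (le_sup_left.trans hQ'), hJV (le_sup_right.trans hQ')⟩
  | sUnion S _ ih =>
    obtain ⟨U, hU, hPU⟩ := hP
    obtain ⟨J, hJ, hJP, hJU⟩ := ih U hU hPU
    exact ⟨J, hJ, hJP, hJU.trans (Set.subset_sUnion_of_mem hU)⟩

/-- If `M` is minimal over `J`, then `J` contains, up to a factor outside `M`, a power of every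
element of `M`. -/
lemma exists_mul_pow_mem_of_forall_prime_eq {J M : Ideal R} [M.IsPrime]
    (hM : ∀ Q : Ideal R, Q.IsPrime → J ≤ Q → Q ≤ M → Q = M) {p : R} (hp : p ∈ M) :
    ∃ y ∉ M, ∃ n : ℕ, y * p ^ n ∈ J := by
  by_contra! h
  have hdisj : Disjoint (J : Set R) (M.primeCompl ⊔ Submonoid.powers p : Submonoid R) := by
    rw [Set.disjoint_left]
    intro x hxJ hx
    obtain ⟨y, hy, _, ⟨n, rfl⟩, rfl⟩ := Submonoid.mem_sup.mp hx
    exact h y hy n hxJ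
  obtain ⟨Q, hQ, hJQ, hdQ⟩ := Ideal.exists_le_prime_disjoint J _ hdisj
  rw [Set.disjoint_left] at hdQ
  have hQM : Q ≤ M := fun x hxQ => by
    by_contra hxM
    exact hdQ hxQ (Submonoid.mem_sup_left (show x ∈ M.primeCompl from hxM))
  have hpQ : p ∈ Q := hM Q hQ hJQ hQM ▸ hp
  exact hdQ hpQ (Submonoid.mem_sup_right (Submonoid.mem_powers p))

/-- Powers of a maximal ideal are primary; this is the case of the square. -/
lemma mem_sq_of_mul_mem_sq {M : Ideal R} (hM : M.IsMaximal) {s x : R} (hs : s ∉ M) (hx : x ∈ M)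
    (h : s * x ∈ M ^ 2) : x ∈ M ^ 2 := by
  obtain ⟨r, m, hm, hrm⟩ := hM.exists_inv hs
  have hx' : x = r * (s * x) + m * x := by linear_combination -x * hrm
  rw [hx']
  exact add_mem (Ideal.mul_mem_left _ _ h) (pow_two M ▸ Ideal.mul_mem_mul hm hx)

/-- A maximal ideal `M` that contains a whole chain of ideals, each contained in the square of the
next, contains the first of them in all its powers. -/
lemma exists_isMaximal_forall_le_pow (J : ℕ → Ideal R) (hmono : Monotone J)
    (hne : ∀ k, J k ≠ ⊤) (hsq : ∀ k, J k ≤ J (k + 1) ^ 2) :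
    ∃ M : Ideal R, M.IsMaximal ∧ J 0 ≤ M ∧ ∀ n, J 0 ≤ M ^ n := by
  have hpow : ∀ k, J 0 ≤ J k ^ 2 ^ k := by
    intro k
    induction k with
    | zero => simp
    | succ k ih =>
      calc J 0 ≤ J k ^ 2 ^ k := ih
        _ ≤ (J (k + 1) ^ 2) ^ 2 ^ k := Ideal.pow_right_mono (hsq k) _
        _ = J (k + 1) ^ 2 ^ (k + 1) := by rw [← pow_mul, pow_succ' 2 k]
  have hsup : (⨆ k, J k) ≠ ⊤ := by
    rw [Ideal.ne_top_iff_one, Submodule.mem_iSup_of_directed _ hmono.directed_le]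
    rintro ⟨k, hk⟩
    exact hne k ((Ideal.eq_top_iff_one _).mpr hk)
  obtain ⟨M, hM, hle⟩ := Ideal.exists_le_maximal _ hsup
  have hJM : ∀ k, J k ≤ M := fun k => (le_iSup J k).trans hle
  refine ⟨M, hM, hJM 0, fun n => ?_⟩
  exact (hpow n).trans ((Ideal.pow_right_mono (hJM n) _).trans
    (Ideal.pow_le_pow_right Nat.lt_two_pow_self.le))

lemma le_of_mul_le_mul_of_isUnit {I J L : Ideal R}
    (hL : IsUnit (L : FractionalIdeal R⁰ (FractionRing R))) (h : L * I ≤ L * J) : I ≤ J := by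
  obtain ⟨N, hN⟩ := hL.exists_left_inv
  rw [← FractionalIdeal.coeIdeal_le_coeIdeal (FractionRing R), FractionalIdeal.coeIdeal_mul,
    FractionalIdeal.coeIdeal_mul] at h
  rw [← FractionalIdeal.coeIdeal_le_coeIdeal (FractionRing R)]
  simpa only [← mul_assoc, hN, one_mul] using mul_le_mul_right h N

end Ring

/-! ### Prüfer domains: locally principal and invertible ideals -/

section Domain

variable {D : Type*} [CommRing D] [IsDomain D]

/-- Divisibility is total in the valuation ring `D_P`; here denominators are cleared. -/
lemma IsPruferDomain.exists_mul_eq_mul (hD : IsPruferDomain D) (P : PrimeSpectrum D) (x y : D) :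
    ∃ s ∉ P.asIdeal, ∃ t, s * x = y * t ∨ s * y = x * t := by
  have := hD P
  have key : ∀ x y : D, algebraMap D (Localization.AtPrime P.asIdeal) y ∣ algebraMap D _ x →
      ∃ s ∉ P.asIdeal, ∃ t, s * x = y * t := by
    rintro x y ⟨z, hz⟩
    obtain ⟨⟨t, s⟩, hts⟩ := IsLocalization.surj P.asIdeal.primeCompl z
    refine ⟨s, s.2, t, ?_⟩
    apply IsLocalization.injective (Localization.AtPrime P.asIdeal)
      P.asIdeal.primeCompl_le_nonZeroDivisors
    simp only [map_mul, hz]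
    simp only at hts
    rw [← hts]
    ring
  rcases ValuationRing.dvd_total (algebraMap D (Localization.AtPrime P.asIdeal) y)
    (algebraMap D _ x) with h | h
  · obtain ⟨s, hs, t, ht⟩ := key x y h
    exact ⟨s, hs, t, Or.inl ht⟩
  · obtain ⟨s, hs, t, ht⟩ := key y x h
    exact ⟨s, hs, t, Or.inr ht⟩

/-- A finitely generated ideal of a Prüfer domain is locally principal, generated at each prime by
one of its own elements. -/
lemma IsPruferDomain.exists_forall_dvd_mul (hD : IsPruferDomain D) (P : PrimeSpectrum D)
    {I : Ideal D} (hI : I.FG) : ∃ a ∈ I, ∃ s ∉ P.asIdeal, ∀ x ∈ I, a ∣ s * x := by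
  induction I, hI using Submodule.fg_induction with
  | singleton x =>
    refine ⟨x, Submodule.mem_span_singleton_self x, 1, P.2.one_notMem, fun y hy => ?_⟩
    rw [one_mul]
    exact Ideal.mem_span_singleton.mp hy
  | sup I J _ _ ihI ihJ =>
    obtain ⟨a, ha, s, hs, has⟩ := ihI
    obtain ⟨b, hb, t, ht, hbt⟩ := ihJ
    obtain ⟨u, hu, v, huv⟩ := hD.exists_mul_eq_mul P a b
    have hmul : u * s * t ∉ P.asIdeal := P.2.mul_notMem (P.2.mul_notMem hu hs) ht
    rcases huv with huv | huv
    · refine ⟨b, Submodule.mem_sup_right hb, u * s * t, hmul, fun z hz => ?_⟩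
      obtain ⟨x, hx, y, hy, rfl⟩ := Submodule.mem_sup.mp hz
      obtain ⟨c, hc⟩ := has x hx
      obtain ⟨d, hd⟩ := hbt y hy
      exact ⟨t * v * c + u * s * d, by
        linear_combination u * t * hc + u * s * hd + t * c * huv⟩
    · refine ⟨a, Submodule.mem_sup_left ha, u * s * t, hmul, fun z hz => ?_⟩
      obtain ⟨x, hx, y, hy, rfl⟩ := Submodule.mem_sup.mp hz
      obtain ⟨c, hc⟩ := has x hx
      obtain ⟨d, hd⟩ := hbt y hy
      exact ⟨u * t * c + s * v * d, by
        linear_combination u * t * hc + u * s * hd + s * d * huv⟩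

/-- Nonzero finitely generated ideals of a Prüfer domain are invertible: if `I D_P = a D_P` and
`s I ⊆ (a)` with `s ∉ P`, then `s / a ∈ I⁻¹`, so that `s = (s / a) a ∈ I * I⁻¹`; hence `I * I⁻¹` is
contained in no prime ideal. -/
lemma isUnit_coeIdeal_of_fg (hD : IsPruferDomain D) {I : Ideal D} (hI : I.FG) (h0 : I ≠ ⊥) :
    IsUnit (I : FractionalIdeal D⁰ (FractionRing D)) := by
  have h0' : (I : FractionalIdeal D⁰ (FractionRing D)) ≠ 0 :=
    FractionalIdeal.coeIdeal_ne_zero.mpr h0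
  rw [← FractionalIdeal.mul_inv_cancel_iff_isUnit]
  obtain ⟨T, hT⟩ := FractionalIdeal.le_one_iff_exists_coeIdeal.mp
    (FractionalIdeal.mul_le.mpr fun x hx y hy =>
      mul_comm y x ▸ (FractionalIdeal.mem_inv_iff h0').mp hy x hx :
      (I : FractionalIdeal D⁰ (FractionRing D)) * (I : FractionalIdeal D⁰ (FractionRing D))⁻¹ ≤ 1)
  rw [← hT]
  suffices T = ⊤ by rw [this, FractionalIdeal.coeIdeal_top]
  by_contra hne
  obtain ⟨P, hP, hTP⟩ := Ideal.exists_le_maximal T hne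
  obtain ⟨a, ha, s, hs, has⟩ := hD.exists_forall_dvd_mul ⟨P, hP.isPrime⟩ hI
  have ha0 : a ≠ 0 := by
    rintro rfl
    refine h0 ((Submodule.eq_bot_iff _).mpr fun x hx => ?_)
    have hsx := zero_dvd_iff.mp (has x hx)
    exact (mul_eq_zero.mp hsx).resolve_left fun h => hs (h ▸ P.zero_mem)
  have ha0' : algebraMap D (FractionRing D) a ≠ 0 := by simpa using ha0
  have hsa : algebraMap D (FractionRing D) s / algebraMap D _ a ∈
      (I : FractionalIdeal D⁰ (FractionRing D))⁻¹ := by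
    rw [FractionalIdeal.mem_inv_iff h0']
    intro y hy
    obtain ⟨x, hx, rfl⟩ := (FractionalIdeal.mem_coeIdeal D⁰).mp hy
    obtain ⟨c, hc⟩ := has x hx
    refine (FractionalIdeal.mem_one_iff D⁰).mpr ⟨c, ?_⟩
    rw [div_mul_eq_mul_div, eq_div_iff ha0', ← map_mul, ← map_mul, hc, mul_comm]
  have hmem := FractionalIdeal.mul_mem_mul (FractionalIdeal.mem_coeIdeal_of_mem D⁰ ha) hsa
  rw [mul_div_cancel₀ _ ha0', ← hT] at hmem
  obtain ⟨s', hs', hss⟩ := (FractionalIdeal.mem_coeIdeal D⁰).mp hmem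
  rw [IsFractionRing.injective D (FractionRing D) hss] at hs'
  exact hs (hTP hs')

/-- An invertible ideal divides every ideal that it contains. -/
lemma exists_mul_eq_of_le {I L : Ideal D}
    (hL : IsUnit (L : FractionalIdeal D⁰ (FractionRing D))) (hIL : I ≤ L) :
    ∃ J : Ideal D, L * J = I := by
  obtain ⟨N, hN⟩ := hL.exists_right_inv
  have hle : (I : FractionalIdeal D⁰ (FractionRing D)) * N ≤ 1 := by
    rw [← hN]
    exact mul_le_mul_left ((FractionalIdeal.coeIdeal_le_coeIdeal _).mpr hIL) N
  obtain ⟨J, hJ⟩ := FractionalIdeal.le_one_iff_exists_coeIdeal.mp hle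
  refine ⟨J, FractionalIdeal.coeIdeal_injective (K := FractionRing D) ?_⟩
  simp only [FractionalIdeal.coeIdeal_mul]
  rw [hJ, mul_left_comm, hN, mul_one]

/-! ### Radical ideals above a finitely generated ideal -/

/-- The step of the iteration: a proper finitely generated ideal that is not radical is contained
in the square of a larger one, namely of `(I : c)` for any `c ∉ I` with `c ^ 2 ∈ I`. -/
lemma exists_le_sq_of_not_isRadical (hD : IsPruferDomain D) {I : Ideal D} (hI : I.FG)
    (h0 : I ≠ ⊥) (hrad : ¬ I.IsRadical) :
    ∃ J : Ideal D, J.FG ∧ J ≠ ⊤ ∧ I ≤ J ∧ I ≤ J ^ 2 := by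
  obtain ⟨c, hc2, hc⟩ : ∃ c, c ^ 2 ∈ I ∧ c ∉ I := by
    by_contra! h
    exact hrad ((Ideal.isRadical_iff_pow_one_lt (k := 2) (by norm_num)).mpr h)
  have hspan : (Ideal.span {c}).FG := ⟨{c}, by simp⟩
  set L := I ⊔ Ideal.span {c} with hLdef
  have hcL : c ∈ L := Submodule.mem_sup_right (Ideal.mem_span_singleton_self c)
  have hL : IsUnit (L : FractionalIdeal D⁰ (FractionRing D)) :=
    isUnit_coeIdeal_of_fg hD (Submodule.FG.sup hI hspan) (ne_bot_of_le_ne_bot h0 le_sup_left)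
  obtain ⟨J, hJ⟩ := exists_mul_eq_of_le hL (le_sup_left : I ≤ L)
  have hIJ : I ≤ J := hJ ▸ Ideal.mul_le_right
  have hcJ : Ideal.span {c} ≤ J := by
    refine le_of_mul_le_mul_of_isUnit hL ?_
    rw [hJ, hLdef, Ideal.sup_mul]
    refine sup_le Ideal.mul_le_left ?_
    rw [Ideal.span_singleton_mul_span_singleton, Ideal.span_singleton_le_iff_mem, ← pow_two]
    exact hc2
  refine ⟨J, ?_, ?_, hIJ, ?_⟩
  · refine Ideal.fg_of_isUnit (S := D⁰) (IsFractionRing.injective D (FractionRing D)) J ?_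
    have hu := isUnit_coeIdeal_of_fg hD hI h0
    rw [← hJ, FractionalIdeal.coeIdeal_mul] at hu
    exact isUnit_of_mul_isUnit_right hu
  · rintro rfl
    rw [Ideal.mul_top] at hJ
    exact hc (hJ ▸ hcL)
  · calc I = L * J := hJ.symm
      _ ≤ J * J := Ideal.mul_mono_left (sup_le hIJ hcJ)
      _ = J ^ 2 := (pow_two J).symm

/-- If the non-idempotent maximal ideal `M` is minimal over `J`, then `J` is not contained in every
power of `M`. For `p ∈ M` outside `M ^ 2` one has `M D_M = p D_M`, so that `p ^ k ∈ J D_M` for some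
`k`, whereas `p ^ k` is not a multiple of `p ^ (k + 1)` in `D_M`. -/
lemma exists_not_le_pow (hD : IsPruferDomain D) {J M : Ideal D} (hM : M.IsMaximal)
    (hidem : M ≠ M ^ 2)
    (hmin : ∀ Q : Ideal D, Q.IsPrime → J ≤ Q → Q ≤ M → Q = M) : ∃ n : ℕ, ¬ J ≤ M ^ n := by
  by_contra! hJ
  have hMp := hM.isPrime
  obtain ⟨p, hp, hp2⟩ : ∃ p ∈ M, p ∉ M ^ 2 := by
    by_contra! h
    exact hidem (le_antisymm h (Ideal.pow_le_self two_ne_zero))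
  have hp0 : p ≠ 0 := fun h => hp2 (h ▸ (M ^ 2).zero_mem)
  have hgen : ∀ x ∈ M, ∃ s ∉ M, p ∣ s * x := by
    intro x hx
    obtain ⟨s, hs, t, h | h⟩ := hD.exists_mul_eq_mul ⟨M, hMp⟩ x p
    · exact ⟨s, hs, t, h⟩
    · refine ⟨t, fun ht => hp2 (mem_sq_of_mul_mem_sq hM hs hp ?_), s, by
        linear_combination -h⟩
      rw [h, pow_two]
      exact Ideal.mul_mem_mul hx ht
  have hpow : ∀ n : ℕ, ∀ x ∈ M ^ n, ∃ s ∉ M, p ^ n ∣ s * x := by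
    intro n
    induction n with
    | zero => exact fun x _ => ⟨1, hMp.one_notMem, by simp⟩
    | succ n ih =>
      intro x hx
      rw [pow_succ] at hx
      induction hx using Submodule.mul_induction_on' with
      | mem_mul_mem y hy z hz =>
        obtain ⟨s, hs, c, hc⟩ := ih y hy
        obtain ⟨t, ht, d, hd⟩ := hgen z hz
        exact ⟨s * t, hMp.mul_notMem hs ht, c * d, by
          linear_combination t * z * hc + p ^ n * c * hd⟩
      | add y _ z _ ihy ihz =>
        obtain ⟨s, hs, c, hc⟩ := ihy
        obtain ⟨t, ht, d, hd⟩ := ihz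
        exact ⟨s * t, hMp.mul_notMem hs ht, t * c + s * d, by
          linear_combination t * hc + s * hd⟩
  obtain ⟨y, hy, k, hyk⟩ := exists_mul_pow_mem_of_forall_prime_eq hmin hp
  obtain ⟨s, hs, c, hc⟩ := hpow (k + 1) _ (hJ (k + 1) hyk)
  have hsy : s * y = p * c :=
    mul_left_cancel₀ (pow_ne_zero k hp0) (by linear_combination hc)
  exact hMp.mul_notMem hs hy (hsy ▸ M.mul_mem_right c hp)

/-- If the primes containing `J` are maximal and not idempotent, then `J` is contained in a proper
finitely generated radical ideal. -/
lemma exists_isRadical_ge (hD : IsPruferDomain D) {J : Ideal D} (hJ : J.FG) (h0 : J ≠ ⊥)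
    (htop : J ≠ ⊤)
    (hmax : ∀ Q : Ideal D, Q.IsPrime → J ≤ Q → Q.IsMaximal ∧ Q ≠ Q ^ 2) :
    ∃ I : Ideal D, I.FG ∧ I ≠ ⊤ ∧ J ≤ I ∧ I.IsRadical := by
  by_contra! h
  let S := {I : Ideal D // I.FG ∧ I ≠ ⊤ ∧ J ≤ I}
  have step : ∀ I : S, ∃ I' : S, I.1 ≤ I'.1 ∧ I.1 ≤ I'.1 ^ 2 := by
    rintro ⟨I, hI, hIt, hJI⟩
    obtain ⟨I', hI', hIt', hle, hsq⟩ :=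
      exists_le_sq_of_not_isRadical hD hI (ne_bot_of_le_ne_bot h0 hJI) (h I hI hIt hJI)
    exact ⟨⟨I', hI', hIt', hJI.trans hle⟩, hle, hsq⟩
  choose next hle hsq using step
  let chain : ℕ → S := fun n => next^[n] ⟨J, hJ, htop, le_rfl⟩
  have hsucc : ∀ n, chain (n + 1) = next (chain n) := fun n =>
    Function.iterate_succ_apply' next n _
  obtain ⟨M, hM, hJM, hpow⟩ := exists_isMaximal_forall_le_pow (fun n => (chain n).1)
    (monotone_nat_of_le_succ fun n => by rw [hsucc]; exact hle _)
    (fun n => (chain n).2.2.1) (fun n => by simp only [hsucc]; exact hsq _)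
  obtain ⟨n, hn⟩ := exists_not_le_pow hD hM (hmax M hM.isPrime hJM).2
    fun Q hQ hJQ hQM => (hmax Q hQ hJQ).1.eq_of_le hM.ne_top hQM
  exact hn (hpow n)

/-! ### Supports, and density of the non-critical ideals -/

lemma supp_coeIdeal_subset_zeroLocus (I : Ideal D) :
    supp (I : FractionalIdeal D⁰ (FractionRing D)) ⊆ PrimeSpectrum.zeroLocus (I : Set D) := by
  intro P hP
  by_contra hIP
  obtain ⟨a, ha, haP⟩ : ∃ a ∈ I, a ∉ P.asIdeal := Set.not_subset.mp hIP
  refine hP (le_antisymm ?_ fun x hx => ?_)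
  · rw [Submodule.mul_le]
    intro y hy x hx
    obtain ⟨b, -, rfl⟩ := (FractionalIdeal.mem_coeIdeal D⁰).mp hy
    exact (localizationAt P).mul_mem ((localizationAt P).algebraMap_mem b) hx
  · have ha0 : algebraMap D (FractionRing D) a ≠ 0 := by
      simpa using fun h : a = 0 => haP (h ▸ P.asIdeal.zero_mem)
    have hinv : (algebraMap D (FractionRing D) a)⁻¹ ∈ localizationAt P :=
      ⟨1, a, haP, by rw [map_one, one_mul]⟩
    rw [← mul_inv_cancel_left₀ ha0 x]
    exact Submodule.mul_mem_mul (FractionalIdeal.mem_coeIdeal_of_mem D⁰ ha)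
      ((localizationAt P).mul_mem hinv hx)

end Domain

end PruferCritical

/-- The set of non-critical ideals is dense in `X`, where `X` carries the subspace topology of
the inverse topology. -/
theorem mainTheorem11 {D : Type*} [CommRing D] [IsDomain D]
    (hD : PruferCritical.IsPruferDomain D) (X : Set (PrimeSpectrum D))
    (hXmax : X ⊆ PruferCritical.maxSpec D)
    (hX : PruferCritical.IsDiscreteSplittingSet X) :
    @Dense X (TopologicalSpace.induced Subtype.val (PruferCritical.inverseTopology D))
      {P : X | P.1 ∈ X \ PruferCritical.Crit X} := by
  obtain ⟨⟨-, hopen⟩, hidem⟩ := hX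
  refine (@dense_iff_inter_open X (TopologicalSpace.induced Subtype.val
    (PruferCritical.inverseTopology D)) _).mpr ?_
  rintro _ ⟨W, hW, rfl⟩ ⟨P, hPW⟩
  obtain ⟨J, hJ, hJP, hJW⟩ := PruferCritical.exists_fg_zeroLocus_subset
    (@IsOpen.inter _ (PruferCritical.inverseTopology D) _ _ hW hopen) ⟨hPW, P.2⟩
  have hJW' : ∀ Q : PrimeSpectrum D, J ≤ Q.asIdeal → Q ∈ W ∩ X := fun _ hQ => hJW hQ
  -- If `J = 0`, then `V(J)` is the whole spectrum, and `X` contains the idempotent prime `0`.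
  have h0 : J ≠ ⊥ := by
    rintro rfl
    exact hidem ⟨⊥, Ideal.isPrime_bot⟩ (hJW' ⟨⊥, Ideal.isPrime_bot⟩ le_rfl).2 (by simp [pow_two])
  obtain ⟨I, hI, hItop, hJI, hrad⟩ := PruferCritical.exists_isRadical_ge hD hJ h0
    (fun h => P.1.2.ne_top (top_le_iff.mp (h ▸ hJP)))
    fun Q hQ hJQ => by
      have hQX : (⟨Q, hQ⟩ : PrimeSpectrum D) ∈ X := (hJW' ⟨Q, hQ⟩ hJQ).2
      exact ⟨hXmax hQX, hidem _ hQX⟩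
  obtain ⟨M, hM, hIM⟩ := Ideal.exists_le_maximal I hItop
  have hMW := hJW' ⟨M, hM.isPrime⟩ (hJI.trans hIM)
  refine ⟨⟨⟨M, hM.isPrime⟩, hMW.2⟩, hMW.1, hMW.2, fun hcrit => hcrit.2 ⟨I, hrad, ?_, hIM⟩⟩
  refine ⟨(PruferCritical.isUnit_coeIdeal_of_fg hD hI
    (ne_bot_of_le_ne_bot h0 hJI)).exists_right_inv, fun Q hQ => ?_⟩
  have hIQ : I ≤ Q.asIdeal := PruferCritical.supp_coeIdeal_subset_zeroLocus I hQ
  exact (hJW' Q (hJI.trans hIQ)).2
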